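/- **Setting.** Let $M_0\ge 1$ and let $S:[0,1]\to[0,1]$ satisfy: (i) $S$ preserves Lebesgue measure on $[0,1]$; (ii) $S$ is affine on each of the open intervals $\left(\frac{j-1}{M_0},\frac{j}{M_0}\right)$, $j=1,\dots,M_0$ (the atoms); (iii) at every point of $\mathcal E_0=\{0,\frac1{M_0},\dots,1\}$ the one-sided limits of $S$ (from within $[0,1]$) exist and lie in $\mathcal E_0$, and the value of $S$ there is one of these limits; (iv) the slope of $S$ on each atom has absolute value at least $2$. The slopes are then integers; let $L_0$ be the least common multiple of their absolute values. For a positive multiple $n$ of $M_0$ let $\tilde K(n)$ be the largest integer $K\ge 0$ such that $L_0^{K}$ divides $n/M_0$. Put $E_x=\left(\frac{x-1}{n},\frac{x}{n}\right)$ for $x\in[n]=\{1,\dots,n\}$, and let $P_n$ be the $n\times n$ matrix with $(P_n)_{xy}=1/|S'(z)|$ (for any $z\in E_x$) if $S(E_x)\cap E_y\neq\emptyset$, and $(P_n)_{xy}=0$ otherwise. An arc is an interval $I$ in $\mathbb R/2\pi\mathbb Z$, of any endpoint type, of length $|I|\in[0,2\pi]$. **Theorem 2.1 (pointwise Weyl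 law analogue).** There is a function $\varepsilon(n,\ell,K)$ of three variables with the following property. Let $S$ be as above, let $(n_k)_k$ be a sequence of positive multiples of $M_0$ with $\tilde K(n_k)\to\infty$, and suppose that each $P_{n_k}$ is unistochastic: there is an $n_k\times n_k$ unitary matrix $U_{n_k}$ with $|(U_{n_k})_{xy}|^2=(P_{n_k})_{xy}$ for all $x,y$; fix such $U_{n_k}$. Then there are sets $G_{n_k}\subseteq[n_k]$ such that for every choice of orthonormal eigenbases $(\psi^{(n_k,j)})_{j}$ of $U_{n_k}$ with eigenvalues $(e^{i\theta^{(n_k,j)}})_{j}$, and for every sequence of arcs $I(n_k)$ with $$|I(n_k)|\,\tilde K(n_k)\to\infty\quad\text{as }k\to\infty,$$ one has $\#G_{n_k}=n_k\bigl(1-o(|I(n_k)|)\bigr)$ as $k\to\infty$, and for all $k$ with $|I(n_k)|>0$ and all $x\in G_{n_k}$, $$\left|\sum_{j:\,\theta^{(n_k,j)}\in I(n_k)}|\psi^{(n_k,j)}_x|^2-\frac{|I(n_k)|}{2\pi}\right|\le\frac{|I(n_k)|}{2\pi}\,\varepsilon_k,\qquad \varepsilon_k:=\varepsilon\bigl(n_k,|I(n_k)|,\tilde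 K(n_k)\bigr)\to0\quad\text{as }k\to\infty .$$ In particular the sum equals $\frac{|I(n_k)|}{2\pi}(1+o(1))$ as $k\to\infty$, uniformly in $x\in G_{n_k}$, with an error depending only on $n_k$, $|I(n_k)|$ and $\tilde K(n_k)$, and the sets $G_{n_k}$ do not depend on the arcs $I(n_k)$ or their lengths. -/

import Mathlib

open MeasureTheory Filter Topology Asymptotics

namespace QuantumIntervalMap

noncomputable section

/-- The open interval `(x/n, (x+1)/n)`, `x = 0, …, n-1`: the atoms of the partition of `[0,1]` into
`n` equal intervals. -/
def cell (n : ℕ) (x : Fin n) : Set ℝ :=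
  Set.Ioo (((x : ℕ) : ℝ) / n) ((((x : ℕ) : ℝ) + 1) / n)

/-- The endpoints `0, 1/M, …, 1` of the atoms of the partition into `M` equal intervals. -/
def grid (M : ℕ) : Set unitInterval := {e | ∃ i : ℕ, (e : ℝ) = (i : ℝ) / M}

/-- A map `[0,1] → [0,1]` as a function on `ℝ` (constant to the left of `0` and to the right
of `1`), so that one can speak of its derivative; only its values on `(0,1)` are used. -/
def realExt (S : unitInterval → unitInterval) (t : ℝ) : ℝ :=
  (S (Set.projIcc 0 1 zero_le_one t) : ℝ)

/-- The slope of `S` on the atom `cell n x`, for `S` affine on that atom: the derivative at its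
midpoint. -/
def cellSlope (S : unitInterval → unitInterval) (n : ℕ) (x : Fin n) : ℝ :=
  deriv (realExt S) ((((x : ℕ) : ℝ) + 1 / 2) / n)

/-- The conditions on the piecewise-linear map `S : [0,1] → [0,1]` relative to the partition into
`M₀` equal atoms. -/
structure IsAllowable (S : unitInterval → unitInterval) (M₀ : ℕ) : Prop where
  pos : 0 < M₀
  /-- (i) `S` preserves Lebesgue measure on `[0,1]`. -/
  measurePreserving : MeasurePreserving S volume volume
  /-- (ii) `S` is linear (affine) on each atom. -/
  affine : ∀ j : Fin M₀, ∃ a b : ℝ, ∀ t : unitInterval, (t : ℝ) ∈ cell M₀ j →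
    (S t : ℝ) = a * t + b
  /-- (iii) The one-sided limits at the endpoints of the atoms exist and are endpoints of atoms.
  (At `e = 1` there is no right limit and at `e = 0` no left limit: the filter is `⊥`.) -/
  right_limit : ∀ e ∈ grid M₀, ∃ e' ∈ grid M₀, Tendsto S (𝓝[>] e) (𝓝 e')
  left_limit : ∀ e ∈ grid M₀, ∃ e' ∈ grid M₀, Tendsto S (𝓝[<] e) (𝓝 e')
  /-- (iii), continued: at an endpoint, `S` takes the value of one of its one-sided limits. -/
  value : ∀ e ∈ grid M₀, (e < 1 ∧ Tendsto S (𝓝[>] e) (𝓝 (S e))) ∨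
    (0 < e ∧ Tendsto S (𝓝[<] e) (𝓝 (S e)))
  /-- (iv) All slopes are at least two in absolute value. -/
  two_le_slope : ∀ j : Fin M₀, 2 ≤ |cellSlope S M₀ j|

/-- The least common multiple `L₀` of the (absolute values of the) slopes of `S`. The slopes are
integers, see `IsAllowable.exists_int_slope`, so the floor only changes the type. -/
def slopeLcm (S : unitInterval → unitInterval) (M₀ : ℕ) : ℕ :=
  Finset.univ.lcm fun j : Fin M₀ => ⌊|cellSlope S M₀ j|⌋₊

/-- `K̃(n)`: the largest `k` such that `L₀ ^ k` divides `n / M₀` (for `n` a positive multiple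
of `M₀`). -/
def Ktilde (S : unitInterval → unitInterval) (M₀ n : ℕ) : ℕ :=
  multiplicity (slopeLcm S M₀) (n / M₀)

open Classical in
/-- The Markov transition matrix `P_n` of `S`. -/
def markovMatrix (S : unitInterval → unitInterval) (n : ℕ) : Matrix (Fin n) (Fin n) ℝ :=
  fun x y => if (realExt S '' cell n x ∩ cell n y).Nonempty then 1 / |cellSlope S n x| else 0

/-- `U` is a quantization of `S`: a unitary matrix with `|U_xy|² = (P_n)_xy`. -/
structure IsQuantization (S : unitInterval → unitInterval) (n : ℕ)
    (U : Matrix (Fin n) (Fin n) ℂ) : Prop where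
  unitary : U ∈ Matrix.unitaryGroup (Fin n) ℂ
  norm_sq : ∀ x y, ‖U x y‖ ^ 2 = markovMatrix S n x y

/-- `ψ` is an orthonormal basis of eigenvectors of `U` with eigenvalues `exp (i θ_j)`. -/
def IsEigenbasis {n : ℕ} (U : Matrix (Fin n) (Fin n) ℂ) (θ : Fin n → ℝ)
    (ψ : OrthonormalBasis (Fin n) ℂ (EuclideanSpace ℂ (Fin n))) : Prop :=
  ∀ j, U.mulVec (ψ j).ofLp = Complex.exp (θ j * Complex.I) • (ψ j).ofLp

/-- `A` is an interval (arc) in `ℝ / 2πℤ` of length `ℓ`; each of its endpoints may or may not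
belong to it. -/
def IsArc (A : Set Real.Angle) (ℓ : ℝ) : Prop :=
  0 ≤ ℓ ∧ ℓ ≤ 2 * Real.pi ∧ ∃ (a : ℝ) (J : Set ℝ),
    Set.Ioo a (a + ℓ) ⊆ J ∧ J ⊆ Set.Icc a (a + ℓ) ∧ A = (fun t : ℝ => (t : Real.Angle)) '' J

/-- The sum of `|ψ_x^{(j)}|²` over the `j` with `θ_j ∈ A` (mod `2π`): the `(x,x)` entry of the
spectral projection onto the arc `A`. -/
def spectralDiag {n : ℕ} (θ : Fin n → ℝ)
    (ψ : OrthonormalBasis (Fin n) ℂ (EuclideanSpace ℂ (Fin n))) (A : Set Real.Angle)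
    (x : Fin n) : ℝ :=
  ∑ j, Set.indicator {j | (θ j : Real.Angle) ∈ A} (fun j => ‖ψ j x‖ ^ 2) j

/-- The slope of an allowable map on an atom is an integer, the same at every point. -/
theorem IsAllowable.exists_int_slope {S : unitInterval → unitInterval} {M₀ : ℕ}
    (h : IsAllowable S M₀) (j : Fin M₀) :
    ∃ m : ℤ, ∀ z ∈ cell M₀ j, deriv (realExt S) z = m := by
  have hM : (0 : ℝ) < M₀ := by exact_mod_cast h.pos
  have hj : (((j : ℕ) : ℝ) + 1) ≤ M₀ := by exact_mod_cast j.2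
  have hj0 : (0 : ℝ) ≤ ((j : ℕ) : ℝ) := by positivity
  obtain ⟨a, b, hab⟩ := h.affine j
  have hl : ((j : ℕ) : ℝ) / M₀ ∈ Set.Icc (0 : ℝ) 1 :=
    ⟨by positivity, by rw [div_le_one hM]; linarith⟩
  have hr : (((j : ℕ) : ℝ) + 1) / M₀ ∈ Set.Icc (0 : ℝ) 1 :=
    ⟨by positivity, by rw [div_le_one hM]; linarith⟩
  set el : unitInterval := ⟨_, hl⟩ with hel
  set er : unitInterval := ⟨_, hr⟩ with her
  have hlt : el < er := by
    rw [Subtype.mk_lt_mk]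
    gcongr
    linarith
  have key : ∀ t ∈ Set.Ioo el er, (S t : ℝ) = a * t + b := fun t ht => hab t ⟨ht.1, ht.2⟩
  have hcont : Continuous fun t : unitInterval => a * (t : ℝ) + b := by fun_prop
  have nb1 : (𝓝[>] el).NeBot := nhdsGT_neBot_of_exists_gt ⟨er, hlt⟩
  have nb2 : (𝓝[<] er).NeBot := nhdsLT_neBot_of_exists_lt ⟨el, hlt⟩
  obtain ⟨e1, ⟨i1, hi1⟩, ht1⟩ := h.right_limit el ⟨j, rfl⟩
  obtain ⟨e2, ⟨i2, hi2⟩, ht2⟩ := h.left_limit er ⟨j + 1, by simp [her]⟩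
  have E1 : (e1 : ℝ) = a * (el : ℝ) + b := by
    refine tendsto_nhds_unique ((continuous_subtype_val.tendsto _).comp ht1)
      (((hcont.tendsto el).mono_left nhdsWithin_le_nhds).congr' ?_)
    filter_upwards [Ioo_mem_nhdsGT hlt] with t ht using (key t ht).symm
  have E2 : (e2 : ℝ) = a * (er : ℝ) + b := by
    refine tendsto_nhds_unique ((continuous_subtype_val.tendsto _).comp ht2)
      (((hcont.tendsto er).mono_left nhdsWithin_le_nhds).congr' ?_)
    filter_upwards [Ioo_mem_nhdsLT hlt] with t ht using (key t ht).symm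
  have ha : a = ((i2 : ℤ) - (i1 : ℤ) : ℤ) := by
    rw [hi1] at E1
    rw [hi2] at E2
    simp only [hel, her] at E1 E2
    field_simp at E1 E2
    push_cast
    linarith
  refine ⟨(i2 : ℤ) - (i1 : ℤ), fun z hz => ?_⟩
  rw [← ha]
  have : realExt S =ᶠ[𝓝 z] fun t => a * t + b := by
    filter_upwards [Ioo_mem_nhds hz.1 hz.2] with t ht
    have h01 : t ∈ Set.Icc (0 : ℝ) 1 := ⟨hl.1.trans ht.1.le, ht.2.le.trans hr.2⟩
    rw [realExt, Set.projIcc_of_mem zero_le_one h01]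
    exact hab ⟨t, h01⟩ ht
  rw [this.deriv_eq]
  simp

end

end QuantumIntervalMap

/-!
The numbers `|ψ_x^{(j)}|²` are the weights of the spectral measure of `U` at the coordinate `x`, a
probability measure on the circle whose `k`-th Fourier coefficient is `(U ^ k)_{xx}`. Two facts give
the result: for most `x` these coefficients vanish for `1 ≤ k ≤ N`, where `N` is a quarter of
`K̃(n)`, rounded down, and a probability measure with this property gives every arc its normalized
length up to an error `16 / (N + 1)`, which is small compared to `ℓ` once `ℓ K̃(n)` is large.

*Vanishing coefficients.* If `(U ^ k)_{xx} ≠ 0`, there is a closed walk `x → x₁ → ⋯ → x` of length `k`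
in which the image under `S` of each cell meets the next cell. Since `S` expands distances by at least
two on each of its `M₀` atoms, two such walks with the same itinerary of atoms start at most three
cells apart (`IsAllowable.expanding`, `le_three_of_expanding`). There are at most
`M₀ (L₀ + 1) ^ k ≤ M₀ L₀ ^ (2k)` itineraries, but `n ≥ M₀ L₀ ^ K̃(n)`; so for `k ≤ K̃(n) / 4` the
proportion of exceptional `x` is exponentially small in `K̃(n)` (`IsAllowable.card_badSet_div_le`),
hence `o(1 / K̃(n))` and `o(ℓ)`. The exceptional set depends on the powers of `U` only.

*Discrepancy.* Let `h` be the difference of the distribution functions of the spectral measure and of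
the uniform measure, normalized to mean zero. Its convolution with any trigonometric polynomial of
degree at most `N` vanishes (`integral_discrepancy_mul_kernel`), and `h` decreases at most at the rate
`1/(2π)`. Testing against the nonnegative kernel `|∑ sin(mφ) e^{imu}|²`, `φ = π/(N+1)`, which is
concentrated on the scale `1/N`, bounds `sup |h|` by half of itself plus `4 / (N + 1)`
(`abs_discrepancy_le_of_abs_le`). The excess mass of an arc is a difference of two values of `h`.
-/

namespace QuantumIntervalMap

open Real Finset

/-! ### The sawtooth function -/

/-- The `2π`-periodic sawtooth: it has slope `-1/(2π)`, a jump `+1` at each multiple of `2π` (where it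
is continuous from the right), and mean zero. -/
noncomputable def sawtooth (t : ℝ) : ℝ := 1 / 2 - Int.fract (t / (2 * π))

theorem abs_sawtooth_le (t : ℝ) : |sawtooth t| ≤ 1 / 2 := by
  have h0 := Int.fract_nonneg (t / (2 * π))
  have h1 := Int.fract_lt_one (t / (2 * π))
  rw [sawtooth, abs_le]
  constructor <;> linarith

theorem sawtooth_periodic : Function.Periodic sawtooth (2 * π) := by
  intro t
  have : (t + 2 * π) / (2 * π) = t / (2 * π) + 1 := by field_simp
  rw [sawtooth, sawtooth, this, Int.fract_add_one]

theorem measurable_sawtooth : Measurable sawtooth :=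
  measurable_const.sub ((measurable_id.div_const _).fract)

/-- The sawtooth only jumps upwards, so it decreases at most at the rate `1/(2π)`. -/
theorem sawtooth_sub_le (t : ℝ) {s : ℝ} (hs : 0 ≤ s) :
    sawtooth t - s / (2 * π) ≤ sawtooth (t + s) := by
  have hle : t / (2 * π) ≤ (t + s) / (2 * π) := by gcongr; linarith
  have hf : (⌊t / (2 * π)⌋ : ℝ) ≤ ⌊(t + s) / (2 * π)⌋ := by exact_mod_cast Int.floor_mono hle
  simp only [sawtooth, Int.fract]
  rw [add_div] at hf ⊢
  linarith

theorem intervalIntegrable_sawtooth_mul {f : ℝ → ℝ} (hf : Continuous f) (c a b : ℝ) :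
    IntervalIntegrable (fun u => sawtooth (c + u) * f u) volume a b := by
  rw [intervalIntegrable_iff]
  refine Integrable.bdd_mul (c := 1 / 2) (intervalIntegrable_iff.1 (hf.intervalIntegrable a b)) ?_ ?_
  · exact (measurable_sawtooth.comp (measurable_const.add measurable_id)).aestronglyMeasurable
  · exact Eventually.of_forall fun u => abs_sawtooth_le _

theorem integral_sawtooth : ∫ t in (-π)..π, sawtooth t = 0 := by
  have h := sawtooth_periodic.intervalIntegral_add_eq (-π) 0
  have e1 : -π + 2 * π = π := by ring
  rw [e1, zero_add] at h
  rw [h]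
  have hc : ∫ t in (0 : ℝ)..(2 * π), sawtooth t = ∫ t in (0 : ℝ)..(2 * π), (1 / 2 - t / (2 * π)) := by
    refine intervalIntegral.integral_congr_Ioo_of_le (by positivity) fun t ht => ?_
    rw [sawtooth, Int.fract_eq_self.2 ⟨by have := ht.1; positivity, ?_⟩]
    rw [div_lt_one (by positivity)]
    exact ht.2
  rw [hc, intervalIntegral.integral_sub (by simp) (by
    apply Continuous.intervalIntegrable; fun_prop)]
  simp
  field_simp
  ring

/-! ### Nonnegative trigonometric polynomials -/

/-- The trigonometric polynomial `|∑_{m ≤ N} a_m e^{imu}|²`, with real coefficients `a_m`, written out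
as a sum of cosines. -/
noncomputable def kernel (a : ℕ → ℝ) (N : ℕ) (u : ℝ) : ℝ :=
  ∑ m ∈ range (N + 1), ∑ l ∈ range (N + 1), a m * a l * cos (((m : ℝ) - l) * u)

theorem kernel_nonneg (a : ℕ → ℝ) (N : ℕ) (u : ℝ) : 0 ≤ kernel a N u := by
  have : kernel a N u = (∑ m ∈ range (N + 1), a m * cos (m * u)) ^ 2 +
      (∑ m ∈ range (N + 1), a m * sin (m * u)) ^ 2 := by
    rw [kernel, sq, sq, sum_mul_sum, sum_mul_sum, ← sum_add_distrib]
    refine sum_congr rfl fun m _ => ?_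
    rw [← sum_add_distrib]
    refine sum_congr rfl fun l _ => ?_
    rw [sub_mul, cos_sub]
    ring
  rw [this]
  positivity

theorem continuous_kernel (a : ℕ → ℝ) (N : ℕ) : Continuous (kernel a N) := by
  unfold kernel
  fun_prop

theorem kernel_periodic (a : ℕ → ℝ) (N : ℕ) : Function.Periodic (kernel a N) (2 * π) := by
  intro u
  refine sum_congr rfl fun m _ => sum_congr rfl fun l _ => ?_
  have : ((m : ℝ) - l) * (u + 2 * π) = ((m : ℝ) - l) * u + ((m - l : ℤ) : ℝ) * (2 * π) := by
    push_cast; ring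
  rw [this, cos_add_int_mul_two_pi]

theorem kernel_neg (a : ℕ → ℝ) (N : ℕ) (u : ℝ) : kernel a N (-u) = kernel a N u := by
  refine sum_congr rfl fun m _ => sum_congr rfl fun l _ => ?_
  rw [mul_neg, cos_neg]

theorem integral_cos_int_mul (k : ℤ) :
    ∫ u in (-π)..π, cos (k * u) = if k = 0 then 2 * π else 0 := by
  split_ifs with h
  · subst h
    simp
    ring
  · have : (k : ℝ) ≠ 0 := by exact_mod_cast h
    rw [intervalIntegral.integral_comp_mul_left _ this]
    simp [integral_cos, sin_int_mul_pi]

theorem integral_kernel (a : ℕ → ℝ) (N : ℕ) :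
    ∫ u in (-π)..π, kernel a N u = 2 * π * ∑ m ∈ range (N + 1), a m ^ 2 := by
  unfold kernel
  rw [intervalIntegral.integral_finsetSum fun m _ => Continuous.intervalIntegrable (by fun_prop) _ _,
    mul_sum]
  refine sum_congr rfl fun m hm => ?_
  rw [intervalIntegral.integral_finsetSum fun m _ => Continuous.intervalIntegrable (by fun_prop) _ _,
    sum_eq_single_of_mem m hm]
  · simp
    ring
  · intro l _ hl
    have h := integral_cos_int_mul ((m : ℤ) - l)
    rw [if_neg (by omega)] at h
    push_cast at h
    rw [intervalIntegral.integral_const_mul, h, mul_zero]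

theorem integral_cos_int_mul_mul_cos (k : ℤ) :
    ∫ u in (-π)..π, cos (k * u) * cos u =
      (if k + 1 = 0 then π else 0) + (if k - 1 = 0 then π else 0) := by
  have e : ∀ u : ℝ, cos (k * u) * cos u =
      1 / 2 * (cos ((k + 1 : ℤ) * u) + cos ((k - 1 : ℤ) * u)) := by
    intro u
    push_cast
    rw [add_mul, sub_mul, one_mul, cos_add, cos_sub]
    ring
  simp_rw [e]
  rw [intervalIntegral.integral_const_mul, intervalIntegral.integral_add
    (Continuous.intervalIntegrable (by fun_prop) _ _)
    (Continuous.intervalIntegrable (by fun_prop) _ _), integral_cos_int_mul, integral_cos_int_mul]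
  split_ifs <;> ring

/-- If `a` satisfies the recursion of `m ↦ sin (mφ)` and vanishes at `0` and `N + 1`, then the first
Fourier coefficient of the kernel is `c = cos φ` times its mean. For `φ = π / (N + 1)` this is the
largest ratio that a nonnegative trigonometric polynomial of its degree can have, so this kernel
is concentrated on the scale `1 / N`. -/
theorem integral_kernel_mul_cos {a : ℕ → ℝ} {N : ℕ} {c : ℝ} (h0 : a 0 = 0) (hN : a (N + 1) = 0)
    (ha : ∀ m, a (m + 2) + a m = 2 * c * a (m + 1)) :
    ∫ u in (-π)..π, kernel a N u * cos u = c * (2 * π * ∑ m ∈ range (N + 1), a m ^ 2) := by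
  unfold kernel
  simp_rw [sum_mul]
  rw [intervalIntegral.integral_finsetSum fun m _ => Continuous.intervalIntegrable (by fun_prop) _ _,
    mul_sum, mul_sum]
  refine sum_congr rfl fun m hm => ?_
  rw [intervalIntegral.integral_finsetSum fun m _ => Continuous.intervalIntegrable (by fun_prop) _ _]
  have e : ∀ l ∈ range (N + 1),
      ∫ u in (-π)..π, a m * a l * cos (((m : ℝ) - l) * u) * cos u =
        (if l = m + 1 then π * a m * a l else 0) + (if m = l + 1 then π * a m * a l else 0) := by
    intro l _
    have h := integral_cos_int_mul_mul_cos ((m : ℤ) - l)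
    push_cast at h
    simp_rw [mul_assoc (a m * a l)]
    rw [intervalIntegral.integral_const_mul, h]
    have h1 : ((m : ℤ) - l + 1 = 0) ↔ l = m + 1 := by omega
    have h2 : ((m : ℤ) - l - 1 = 0) ↔ m = l + 1 := by omega
    simp only [h1, h2]
    split_ifs <;> ring
  rw [sum_congr rfl e, sum_add_distrib, sum_ite_eq']
  have hm' : m < N + 1 := mem_range.1 hm
  have hA : (if m + 1 ∈ range (N + 1) then π * a m * a (m + 1) else 0) = π * a m * a (m + 1) := by
    split_ifs with h
    · rfl
    · have : m = N := by simp at h; omega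
      rw [this, hN, mul_zero]
  rw [hA]
  rcases m with _ | p
  · simp [h0]
  · simp only [Nat.add_right_cancel_iff]
    rw [sum_ite_eq, if_pos (mem_range.2 (by omega))]
    linear_combination π * a (p + 1) * ha p

/-- A probability measure `∑ w_j δ_{θ_j}` whose Fourier coefficients of order `1, …, N` vanish
integrates trigonometric polynomials of degree at most `N` to their means. -/
theorem sum_mul_kernel {ι : Type*} [Fintype ι] {w θ : ι → ℝ} (a : ℕ → ℝ) {N : ℕ}
    (hw : ∑ j, w j = 1)
    (hc : ∀ k : ℕ, 0 < k → k ≤ N → ∀ τ, ∑ j, w j * cos (k * (τ - θ j)) = 0) (τ : ℝ) :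
    ∑ j, w j * kernel a N (τ - θ j) = ∑ m ∈ range (N + 1), a m ^ 2 := by
  unfold kernel
  simp_rw [mul_sum]
  rw [sum_comm]
  refine sum_congr rfl fun m hm => ?_
  rw [sum_comm, sum_eq_single_of_mem m hm]
  · simp only [sub_self, zero_mul, cos_zero, mul_one]
    rw [← sum_mul, hw]
    ring
  · intro l hl hlm
    have hm := mem_range.1 hm
    have hl := mem_range.1 hl
    simp_rw [mul_left_comm (w _)]
    rw [← mul_sum]
    rcases lt_or_gt_of_ne hlm with h | h
    · have := hc (m - l) (by omega) (by omega) τ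
      rw [Nat.cast_sub h.le] at this
      rw [this, mul_zero]
    · have := hc (l - m) (by omega) (by omega) τ
      rw [Nat.cast_sub h.le] at this
      have e : ∀ j, cos (((m : ℝ) - l) * (τ - θ j)) = cos (((l : ℝ) - m) * (τ - θ j)) := by
        intro j
        rw [← cos_neg]
        congr 1
        ring
      simp_rw [e]
      rw [this, mul_zero]

/-! ### Discrepancy of a measure with vanishing low Fourier coefficients -/

/-- For weights of sum one, the distribution function of the measure `∑ w_j δ_{θ_j}` on the circle minus
that of the uniform measure, normalized to have mean zero. -/
noncomputable def discrepancy {ι : Type*} [Fintype ι] (w θ : ι → ℝ) (t : ℝ) : ℝ :=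
  ∑ j, w j * sawtooth (t - θ j)

/-- The discrepancy is orthogonal to every translate of the kernel: moving the translation from the
sawtooths to the kernel, the sum over `j` becomes a constant and the sawtooth has mean zero. -/
theorem integral_discrepancy_mul_kernel {ι : Type*} [Fintype ι] {w θ : ι → ℝ} (a : ℕ → ℝ) {N : ℕ}
    (hw : ∑ j, w j = 1)
    (hc : ∀ k : ℕ, 0 < k → k ≤ N → ∀ τ, ∑ j, w j * cos (k * (τ - θ j)) = 0) (t : ℝ) :
    ∫ u in (-π)..π, discrepancy w θ (t + u) * kernel a N u = 0 := by
  have e1 : ∀ j, ∫ u in (-π)..π, sawtooth (t - θ j + u) * kernel a N u =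
      ∫ v in (-π)..π, sawtooth v * kernel a N (t - v - θ j) := by
    intro j
    have hp : Function.Periodic (fun v => sawtooth v * kernel a N (v - (t - θ j))) (2 * π) := by
      intro v
      have := kernel_periodic a N (v - (t - θ j))
      change sawtooth (v + 2 * π) * kernel a N (v + 2 * π - (t - θ j)) = _
      rw [sawtooth_periodic v, add_sub_right_comm, this]
    have h1 := intervalIntegral.integral_comp_add_left (a := -π) (b := π)
      (fun v => sawtooth v * kernel a N (v - (t - θ j))) (t - θ j)
    simp only [add_sub_cancel_left] at h1
    rw [h1]
    have h2 := hp.intervalIntegral_add_eq (t - θ j + -π) (-π)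
    rw [show t - θ j + -π + 2 * π = t - θ j + π by ring, show -π + 2 * π = π by ring] at h2
    rw [h2]
    refine intervalIntegral.integral_congr fun v _ => ?_
    rw [← kernel_neg]
    congr 2
    ring
  have e2 : ∀ u, discrepancy w θ (t + u) * kernel a N u =
      ∑ j, w j * (sawtooth (t - θ j + u) * kernel a N u) := by
    intro u
    rw [discrepancy, sum_mul]
    refine sum_congr rfl fun j _ => ?_
    rw [show t + u - θ j = t - θ j + u by ring]
    ring
  simp_rw [e2]
  rw [intervalIntegral.integral_finsetSum fun j _ =>
    (intervalIntegrable_sawtooth_mul (continuous_kernel a N) _ _ _).const_mul _]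
  simp_rw [intervalIntegral.integral_const_mul, e1, ← intervalIntegral.integral_const_mul]
  rw [← intervalIntegral.integral_finsetSum]
  · have e3 : ∀ v, ∑ j, w j * (sawtooth v * kernel a N (t - v - θ j)) =
        (∑ m ∈ range (N + 1), a m ^ 2) * sawtooth v := by
      intro v
      rw [← sum_mul_kernel a hw hc (t - v), sum_mul]
      exact sum_congr rfl fun j _ => by ring
    simp_rw [e3]
    rw [intervalIntegral.integral_const_mul, integral_sawtooth, mul_zero]
  · intro j _
    have := intervalIntegrable_sawtooth_mul (f := fun v => kernel a N (t - v - θ j))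
      ((continuous_kernel a N).comp (by fun_prop)) 0 (-π) π
    simp only [zero_add] at this
    exact this.const_mul _

theorem intervalIntegrable_discrepancy_mul {ι : Type*} [Fintype ι] (w θ : ι → ℝ) {f : ℝ → ℝ}
    (hf : Continuous f) (t a b : ℝ) :
    IntervalIntegrable (fun u => discrepancy w θ (t + u) * f u) volume a b := by
  have e : (fun u => discrepancy w θ (t + u) * f u) =
      ∑ j, fun u => w j * (sawtooth (t - θ j + u) * f u) := by
    funext u
    rw [discrepancy, sum_mul, Finset.sum_apply]
    refine sum_congr rfl fun j _ => ?_
    rw [show t + u - θ j = t - θ j + u by ring]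
    ring
  rw [e]
  exact IntervalIntegrable.sum _ fun j _ => (intervalIntegrable_sawtooth_mul hf _ _ _).const_mul _

theorem abs_discrepancy_le_half {ι : Type*} [Fintype ι] {w θ : ι → ℝ} (hw0 : ∀ j, 0 ≤ w j)
    (hw : ∑ j, w j = 1) (t : ℝ) : |discrepancy w θ t| ≤ 1 / 2 := by
  calc |discrepancy w θ t| ≤ ∑ j, |w j * sawtooth (t - θ j)| := abs_sum_le_sum_abs _ _
    _ ≤ ∑ j, w j * (1 / 2) := by
        gcongr with j
        rw [abs_mul, abs_of_nonneg (hw0 j)]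
        exact mul_le_mul_of_nonneg_left (abs_sawtooth_le _) (hw0 j)
    _ = 1 / 2 := by rw [← sum_mul, hw, one_mul]

/-- The discrepancy decreases at most at the rate `1/(2π)`: a point mass is nonnegative, and only the
uniform measure pulls it down. -/
theorem discrepancy_sub_le {ι : Type*} [Fintype ι] {w θ : ι → ℝ} (hw0 : ∀ j, 0 ≤ w j)
    (hw : ∑ j, w j = 1) (t : ℝ) {s : ℝ} (hs : 0 ≤ s) :
    discrepancy w θ t - s / (2 * π) ≤ discrepancy w θ (t + s) := by
  have e : s / (2 * π) = ∑ j, w j * (s / (2 * π)) := by rw [← sum_mul, hw, one_mul]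
  rw [discrepancy, discrepancy, e, ← sum_sub_distrib]
  refine sum_le_sum fun j _ => ?_
  have := mul_le_mul_of_nonneg_left (sawtooth_sub_le (t - θ j) hs) (hw0 j)
  rw [show t + s - θ j = t - θ j + s by ring]
  linarith

theorem one_le_one_sub_cos_div {δ u : ℝ} (h0 : 0 < δ) (hδ : δ ≤ π) (hδu : δ ≤ |u|) (hu : |u| ≤ π) :
    1 ≤ (1 - cos u) / (1 - cos δ) := by
  have h1 : cos u ≤ cos δ := by
    rw [← cos_abs u]
    exact cos_le_cos_of_nonneg_of_le_pi h0.le hu hδu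
  have h2 : cos δ < 1 := by
    have := cos_lt_cos_of_nonneg_of_le_pi le_rfl hδ h0
    rwa [cos_zero] at this
  rw [one_le_div (by linarith)]
  linarith

/-- If the discrepancy is large at `t`, it stays large on an interval of length `2δ` to one side of `t`,
because it cannot move quickly in one of the two directions. Averaged against the kernel centred
on that interval it must vanish, which is impossible unless its values elsewhere compensate. This
improves any uniform bound `M` to `M / 2` up to an error `4 / (N + 1)`. -/
theorem abs_discrepancy_le_of_abs_le {ι : Type*} [Fintype ι] {w θ : ι → ℝ} (hw0 : ∀ j, 0 ≤ w j)
    (hw : ∑ j, w j = 1) {N : ℕ} (hN : 3 ≤ N)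
    (hc : ∀ k : ℕ, 0 < k → k ≤ N → ∀ τ, ∑ j, w j * cos (k * (τ - θ j)) = 0) {M : ℝ}
    (hM : ∀ t, |discrepancy w θ t| ≤ M) (t : ℝ) :
    |discrepancy w θ t| ≤ 4 / (N + 1) + M / 2 := by
  set φ : ℝ := π / (N + 1) with hφ
  -- Half the length of the interval; the factor `4 ≥ π` makes the kernel mass outside the
  -- interval, measured by `1 - cos`, at most `1 / 4`.
  set δ : ℝ := 4 * φ with hδ
  set a : ℕ → ℝ := fun m => sin (m * φ) with ha
  set Q : ℝ := ∑ m ∈ range (N + 1), a m ^ 2 with hQ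
  have hN' : (3 : ℝ) ≤ N := by exact_mod_cast hN
  have hφ0 : 0 < φ := by positivity
  have hδ0 : 0 < δ := by positivity
  have hφN : φ * (N + 1) = π := by rw [hφ]; field_simp
  have hδπ : δ ≤ π := by nlinarith
  have hM0 : 0 ≤ M := (abs_nonneg _).trans (hM 0)
  have hQ0 : 0 < Q := by
    refine sum_pos' (fun m _ => sq_nonneg _) ⟨1, mem_range.2 (by omega), ?_⟩
    have : 0 < sin φ := sin_pos_of_pos_of_lt_pi hφ0 (by nlinarith)
    simp only [ha, Nat.cast_one, one_mul]
    positivity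
  have hcosδ : cos δ ≤ 1 - 2 / π ^ 2 * δ ^ 2 := cos_le_one_sub_mul_cos_sq (by rw [abs_of_pos hδ0]; exact hδπ)
  have hcosφ : 1 - φ ^ 2 / 2 ≤ cos φ := one_sub_sq_div_two_le_cos
  have hratio : (1 - cos φ) / (1 - cos δ) ≤ 1 / 4 := by
    have hp : 2 * φ ^ 2 ≤ 2 / π ^ 2 * δ ^ 2 := by
      have : π ^ 2 ≤ 16 := by nlinarith [pi_le_four, pi_pos]
      rw [hδ, div_mul_eq_mul_div, le_div_iff₀ (by positivity)]
      nlinarith [sq_nonneg φ]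
    rw [div_le_iff₀ (by nlinarith [sq_pos_of_pos hφ0])]
    linarith
  have hint : ∫ u in (-π)..π, kernel a N u = 2 * π * Q := integral_kernel a N
  have hintc : ∫ u in (-π)..π, kernel a N u * cos u = cos φ * (2 * π * Q) := by
    refine integral_kernel_mul_cos (by simp [ha]) ?_ fun m => ?_
    · simp only [ha, Nat.cast_add, Nat.cast_one]
      rw [mul_comm, hφN, sin_pi]
    · simp only [ha, Nat.cast_add, Nat.cast_one, Nat.cast_ofNat]
      rw [show ((m : ℝ) + 2) * φ = (m + 1) * φ + φ by ring,
        show (m : ℝ) * φ = (m + 1) * φ - φ by ring, sin_add, sin_sub]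
      ring
  have hk := continuous_kernel a N
  -- The sign `s = ±1` selects the side of `t` and treats both bounds at once. Points outside the
  -- interval contribute at least `-M`, which the term with `1 - cos u` absorbs.
  have key : ∀ (s c : ℝ), (∀ u ∈ Set.Icc (-π) π,
      c - δ / π - 2 * M * ((1 - cos u) / (1 - cos δ)) ≤ s * discrepancy w θ (t + s * δ + u)) →
      c ≤ 4 / (N + 1) + M / 2 := by
    intro s c h
    have h1 : ∫ u in (-π)..π, (c - δ / π - 2 * M * ((1 - cos u) / (1 - cos δ))) * kernel a N u ≤
        ∫ u in (-π)..π, s * (discrepancy w θ (t + s * δ + u) * kernel a N u) := by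
      refine intervalIntegral.integral_mono_on (by linarith [pi_pos])
        (Continuous.intervalIntegrable (by fun_prop) _ _)
        ((intervalIntegrable_discrepancy_mul w θ hk _ _ _).const_mul _) fun u hu => ?_
      rw [← mul_assoc]
      exact mul_le_mul_of_nonneg_right (h u hu) (kernel_nonneg a N u)
    rw [intervalIntegral.integral_const_mul, integral_discrepancy_mul_kernel a hw hc, mul_zero] at h1
    have e : ∀ u, (c - δ / π - 2 * M * ((1 - cos u) / (1 - cos δ))) * kernel a N u =
        (c - δ / π - 2 * M / (1 - cos δ)) * kernel a N u +
          2 * M / (1 - cos δ) * (kernel a N u * cos u) := by intro u; ring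
    simp_rw [e] at h1
    rw [intervalIntegral.integral_add (Continuous.intervalIntegrable (by fun_prop) _ _)
      (Continuous.intervalIntegrable (by fun_prop) _ _), intervalIntegral.integral_const_mul,
      intervalIntegral.integral_const_mul, hint, hintc] at h1
    have h2 : (c - δ / π - 2 * M * ((1 - cos φ) / (1 - cos δ))) * (2 * π * Q) ≤ 0 := by
      refine le_trans (le_of_eq ?_) h1
      ring
    have h3 : c - δ / π - 2 * M * ((1 - cos φ) / (1 - cos δ)) ≤ 0 := by
      by_contra! hlt
      have : 0 < 2 * π * Q := by positivity
      nlinarith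
    have h4 : δ / π = 4 / (N + 1) := by rw [hδ, hφ]; field_simp
    nlinarith
  have hcos1 : ∀ u, 0 ≤ (1 - cos u) / (1 - cos δ) := fun u =>
    div_nonneg (by linarith [cos_le_one u]) (by linarith [cos_le_one δ])
  have hdπ : (δ + δ) / (2 * π) = δ / π := by field_simp; ring
  have hMt := abs_le.1 (hM t)
  rw [abs_le']
  constructor
  · refine key 1 _ fun u hu => ?_
    rw [one_mul, one_mul]
    rcases le_or_gt |u| δ with hu1 | hu1
    · have hu2 := abs_le.1 hu1
      have h1 := discrepancy_sub_le (θ := θ) hw0 hw t (s := δ + u) (by linarith)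
      have h2 : (δ + u) / (2 * π) ≤ (δ + δ) / (2 * π) := by gcongr; linarith
      have h3 := mul_nonneg hM0 (hcos1 u)
      rw [← add_assoc] at h1
      linarith
    · have h1 := one_le_one_sub_cos_div hδ0 hδπ hu1.le (abs_le.2 hu)
      have h2 := abs_le.1 (hM (t + δ + u))
      have h3 : 0 < δ / π := by positivity
      nlinarith
  · refine key (-1) _ fun u hu => ?_
    rw [neg_one_mul, neg_one_mul]
    rcases le_or_gt |u| δ with hu1 | hu1
    · have hu2 := abs_le.1 hu1
      have h1 := discrepancy_sub_le (θ := θ) hw0 hw (t + -δ + u) (s := δ - u) (by linarith)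
      have h2 : (δ - u) / (2 * π) ≤ (δ + δ) / (2 * π) := by gcongr; linarith
      have h3 := mul_nonneg hM0 (hcos1 u)
      rw [show t + -δ + u + (δ - u) = t by ring] at h1
      linarith
    · have h1 := one_le_one_sub_cos_div hδ0 hδπ hu1.le (abs_le.2 hu)
      have h2 := abs_le.1 (hM (t + -δ + u))
      have h3 : 0 < δ / π := by positivity
      nlinarith

theorem abs_discrepancy_le {ι : Type*} [Fintype ι] {w θ : ι → ℝ} (hw0 : ∀ j, 0 ≤ w j)
    (hw : ∑ j, w j = 1) {N : ℕ}
    (hc : ∀ k : ℕ, 0 < k → k ≤ N → ∀ τ, ∑ j, w j * cos (k * (τ - θ j)) = 0) (t : ℝ) :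
    |discrepancy w θ t| ≤ 8 / (N + 1) := by
  have hbdd : BddAbove (Set.range fun t => |discrepancy w θ t|) :=
    ⟨1 / 2, by rintro _ ⟨t, rfl⟩; exact abs_discrepancy_le_half hw0 hw t⟩
  rcases le_or_gt 3 N with hN | hN
  · have h := ciSup_le (abs_discrepancy_le_of_abs_le hw0 hw hN hc (le_ciSup hbdd))
    have h2 : (8 : ℝ) / (N + 1) = 2 * (4 / (N + 1)) := by ring
    have := le_ciSup hbdd t
    linarith
  · refine (abs_discrepancy_le_half hw0 hw t).trans ?_
    have : (N : ℝ) ≤ 2 := by exact_mod_cast Nat.lt_succ_iff.1 hN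
    rw [div_le_div_iff₀ (by norm_num) (by positivity)]
    linarith

/-! ### Mass of an arc -/

/-- The sawtooths at two points differ, up to a linear term, by the number of lifts of `θ` in the
half-open interval between them. Starting it at `a - η` includes the left endpoint of the arc. -/
theorem indicator_arc_le {A : Set Real.Angle} {a ℓ η θ : ℝ} {J : Set ℝ} (hη : 0 < η) (hℓ : 0 ≤ ℓ)
    (hJ : J ⊆ Set.Icc a (a + ℓ)) (hA : A = (fun t : ℝ => (t : Real.Angle)) '' J) :
    A.indicator (fun _ => (1 : ℝ)) (θ : Real.Angle) ≤
      (ℓ + η) / (2 * π) + sawtooth (a + ℓ - θ) - sawtooth (a - η - θ) := by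
  have hπ : 0 < 2 * π := by positivity
  have e : (ℓ + η) / (2 * π) + sawtooth (a + ℓ - θ) - sawtooth (a - η - θ) =
      ⌊(a + ℓ - θ) / (2 * π)⌋ - ⌊(a - η - θ) / (2 * π)⌋ := by
    simp only [sawtooth, Int.fract]
    field_simp
    ring
  rw [e]
  by_cases h : (θ : Real.Angle) ∈ A
  · rw [Set.indicator_of_mem h]
    rw [hA] at h
    obtain ⟨t, ht, htθ⟩ := h
    obtain ⟨m, hm⟩ := Real.Angle.angle_eq_iff_two_pi_dvd_sub.1 htθ
    have htJ := hJ ht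
    have h1 : m ≤ ⌊(a + ℓ - θ) / (2 * π)⌋ := by
      rw [Int.le_floor, le_div_iff₀ hπ]
      linarith [htJ.2]
    have h2 : ⌊(a - η - θ) / (2 * π)⌋ < m := by
      rw [Int.floor_lt, div_lt_iff₀ hπ]
      linarith [htJ.1]
    have h3 : ⌊(a - η - θ) / (2 * π)⌋ + 1 ≤ ⌊(a + ℓ - θ) / (2 * π)⌋ := by omega
    have : ((⌊(a - η - θ) / (2 * π)⌋ : ℝ) + 1) ≤ ⌊(a + ℓ - θ) / (2 * π)⌋ := by exact_mod_cast h3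
    linarith
  · rw [Set.indicator_of_notMem h]
    have : (a - η - θ) / (2 * π) ≤ (a + ℓ - θ) / (2 * π) := by gcongr; linarith
    have : (⌊(a - η - θ) / (2 * π)⌋ : ℝ) ≤ ⌊(a + ℓ - θ) / (2 * π)⌋ := by
      exact_mod_cast Int.floor_mono this
    linarith

/-- Ending the half-open interval at `a + ℓ - η` keeps it inside the arc, and its length, less than `2π`,
admits at most one lift of `θ`. -/
theorem le_indicator_arc {A : Set Real.Angle} {a ℓ η θ : ℝ} {J : Set ℝ} (hη : 0 < η)
    (hℓ : ℓ ≤ 2 * π)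
    (hJ : Set.Ioo a (a + ℓ) ⊆ J) (hA : A = (fun t : ℝ => (t : Real.Angle)) '' J) :
    (ℓ - η) / (2 * π) + sawtooth (a + ℓ - η - θ) - sawtooth (a - θ) ≤
      A.indicator (fun _ => (1 : ℝ)) (θ : Real.Angle) := by
  have hπ : 0 < 2 * π := by positivity
  have e : (ℓ - η) / (2 * π) + sawtooth (a + ℓ - η - θ) - sawtooth (a - θ) =
      ⌊(a + ℓ - η - θ) / (2 * π)⌋ - ⌊(a - θ) / (2 * π)⌋ := by
    simp only [sawtooth, Int.fract]
    field_simp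
    ring
  rw [e]
  set q := ⌊(a + ℓ - η - θ) / (2 * π)⌋ with hq
  set p := ⌊(a - θ) / (2 * π)⌋ with hp
  have hq1 : q * (2 * π) ≤ a + ℓ - η - θ := by
    rw [← le_div_iff₀ hπ]; exact Int.floor_le _
  have hp1 : a - θ < (p + 1) * (2 * π) := by
    rw [← div_lt_iff₀ hπ]; exact Int.lt_floor_add_one _
  have hqp : q ≤ p + 1 := by
    have : (q : ℝ) < ((p + 2 : ℤ) : ℝ) := by
      push_cast
      by_contra! h
      nlinarith
    have := Int.cast_lt.1 this
    omega
  by_cases h : (θ : Real.Angle) ∈ A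
  · rw [Set.indicator_of_mem h]
    have : (q : ℝ) ≤ p + 1 := by exact_mod_cast hqp
    linarith
  · rw [Set.indicator_of_notMem h]
    have : q ≤ p := by
      by_contra! hlt
      have hqe : q = p + 1 := by omega
      apply h
      rw [hA]
      refine ⟨θ + q * (2 * π), hJ ⟨?_, ?_⟩, ?_⟩
      · rw [hqe]; push_cast; linarith
      · linarith
      · exact Real.Angle.angle_eq_iff_two_pi_dvd_sub.2 ⟨q, by ring⟩
    have : (q : ℝ) ≤ p := by exact_mod_cast this
    linarith

theorem abs_sum_indicator_arc_sub_le {ι : Type*} [Fintype ι] {w θ : ι → ℝ} (hw0 : ∀ j, 0 ≤ w j)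
    (hw : ∑ j, w j = 1) {N : ℕ}
    (hc : ∀ k : ℕ, 0 < k → k ≤ N → ∀ τ, ∑ j, w j * cos (k * (τ - θ j)) = 0)
    {A : Set Real.Angle} {ℓ : ℝ} (hA : IsArc A ℓ) :
    |∑ j, w j * A.indicator (fun _ => (1 : ℝ)) (θ j : Real.Angle) - ℓ / (2 * π)| ≤
      16 / (N + 1) := by
  obtain ⟨hℓ0, hℓ, a, J, hJ1, hJ2, hA⟩ := hA
  have hd := fun t => abs_le.1 (abs_discrepancy_le hw0 hw hc t)
  have hsum : ∀ c s t, ∑ j, w j * (c + sawtooth (s - θ j) - sawtooth (t - θ j)) =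
      c + discrepancy w θ s - discrepancy w θ t := by
    intro c s t
    simp only [mul_sub, mul_add, sum_add_distrib, sum_sub_distrib, ← sum_mul, hw, one_mul,
      discrepancy]
  have hN : (16 : ℝ) / (N + 1) = 2 * (8 / (N + 1)) := by ring
  refine le_of_forall_pos_le_add fun ε hε => ?_
  set η := ε * (2 * π) with hη
  have hη0 : 0 < η := by positivity
  have hηε : η / (2 * π) = ε := by rw [hη]; field_simp
  rw [abs_le]
  constructor
  · have h1 := sum_le_sum fun j (_ : j ∈ univ) => mul_le_mul_of_nonneg_left
      (le_indicator_arc (θ := θ j) hη0 hℓ hJ1 hA) (hw0 j)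
    rw [hsum] at h1
    rw [sub_div, hηε] at h1
    linarith [(hd (a + ℓ - η)).1, (hd a).2]
  · have h1 := sum_le_sum fun j (_ : j ∈ univ) => mul_le_mul_of_nonneg_left
      (indicator_arc_le (θ := θ j) hη0 hℓ0 hJ2 hA) (hw0 j)
    rw [hsum] at h1
    rw [add_div, hηε] at h1
    linarith [(hd (a + ℓ)).2, (hd (a - η)).1]

/-! ### Spectral measures of unitary matrices -/

/-- The diagonal entries of the powers of `U` are the Fourier coefficients of the spectral measure
`∑ |ψ_x^{(j)}|² δ_{θ_j}` at the coordinate vector of `x`. -/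
theorem pow_apply_self_eq_sum {n : ℕ} {U : Matrix (Fin n) (Fin n) ℂ} {θ : Fin n → ℝ}
    {ψ : OrthonormalBasis (Fin n) ℂ (EuclideanSpace ℂ (Fin n))} (h : IsEigenbasis U θ ψ)
    (k : ℕ) (x : Fin n) :
    (U ^ k) x x = ∑ j, ((‖ψ j x‖ ^ 2 : ℝ) : ℂ) * Complex.exp ((k * θ j : ℝ) * Complex.I) := by
  have hpow : ∀ j, (U ^ k).mulVec (ψ j).ofLp =
      Complex.exp ((k * θ j : ℝ) * Complex.I) • (ψ j).ofLp := by
    intro j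
    induction k with
    | zero => simp
    | succ k ih =>
      rw [pow_succ, ← Matrix.mulVec_mulVec, h j, Matrix.mulVec_smul, ih, smul_smul,
        ← Complex.exp_add]
      congr 2
      push_cast
      ring
  have hexp := ψ.sum_repr' (EuclideanSpace.single x 1)
  have hexp' : Pi.single x (1 : ℂ) = ∑ j, (starRingEnd ℂ) (ψ j x) • (ψ j).ofLp := by
    have := congrArg WithLp.ofLp hexp
    simp only [WithLp.ofLp_sum, WithLp.ofLp_smul, EuclideanSpace.inner_single_right, one_mul] at this
    rw [this]
    simp
  have h1 : (U ^ k) x x = ((U ^ k).mulVec (Pi.single x 1)) x := by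
    rw [Matrix.mulVec_single_one]; rfl
  rw [h1, hexp', Matrix.mulVec_sum, Finset.sum_apply]
  refine sum_congr rfl fun j _ => ?_
  rw [Matrix.mulVec_smul, hpow]
  simp only [Pi.smul_apply, smul_eq_mul]
  have : ((‖ψ j x‖ ^ 2 : ℝ) : ℂ) = (starRingEnd ℂ) (ψ j x) * ψ j x := by
    rw [Complex.conj_mul']; push_cast; rfl
  rw [this]
  ring

theorem sum_norm_sq_mul_cos_eq_zero {n : ℕ} {U : Matrix (Fin n) (Fin n) ℂ} {θ : Fin n → ℝ}
    {ψ : OrthonormalBasis (Fin n) ℂ (EuclideanSpace ℂ (Fin n))} (h : IsEigenbasis U θ ψ)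
    {k : ℕ} {x : Fin n} (hk : (U ^ k) x x = 0) (τ : ℝ) :
    ∑ j, ‖ψ j x‖ ^ 2 * cos (k * (τ - θ j)) = 0 := by
  rw [pow_apply_self_eq_sum h] at hk
  have hre := congrArg Complex.re hk
  have him := congrArg Complex.im hk
  simp only [Complex.re_sum, Complex.im_sum, Complex.re_ofReal_mul, Complex.im_ofReal_mul,
    Complex.exp_ofReal_mul_I_re, Complex.exp_ofReal_mul_I_im, Complex.zero_re,
    Complex.zero_im] at hre him
  have : ∀ j, ‖ψ j x‖ ^ 2 * cos (k * (τ - θ j)) =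
      cos (k * τ) * (‖ψ j x‖ ^ 2 * cos (k * θ j)) +
        sin (k * τ) * (‖ψ j x‖ ^ 2 * sin (k * θ j)) := by
    intro j
    rw [mul_sub, cos_sub]
    ring
  simp_rw [this]
  rw [sum_add_distrib, ← mul_sum, ← mul_sum, hre, him]
  simp

theorem sum_norm_sq_eq_one {n : ℕ} {U : Matrix (Fin n) (Fin n) ℂ} {θ : Fin n → ℝ}
    {ψ : OrthonormalBasis (Fin n) ℂ (EuclideanSpace ℂ (Fin n))} (h : IsEigenbasis U θ ψ)
    (x : Fin n) : ∑ j, ‖ψ j x‖ ^ 2 = 1 := by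
  have := pow_apply_self_eq_sum h 0 x
  simp only [pow_zero, Matrix.one_apply_eq, Nat.cast_zero, zero_mul, Complex.ofReal_zero,
    Complex.exp_zero, mul_one] at this
  exact_mod_cast this.symm

theorem abs_spectralDiag_sub_le {n : ℕ} {U : Matrix (Fin n) (Fin n) ℂ} {θ : Fin n → ℝ}
    {ψ : OrthonormalBasis (Fin n) ℂ (EuclideanSpace ℂ (Fin n))} (h : IsEigenbasis U θ ψ)
    {N : ℕ} {x : Fin n} (hx : ∀ k, 0 < k → k ≤ N → (U ^ k) x x = 0)
    {A : Set Real.Angle} {ℓ : ℝ} (hA : IsArc A ℓ) :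
    |spectralDiag θ ψ A x - ℓ / (2 * π)| ≤ 16 / (N + 1) := by
  classical
  have := abs_sum_indicator_arc_sub_le (w := fun j => ‖ψ j x‖ ^ 2) (θ := θ)
    (fun j => by positivity) (sum_norm_sq_eq_one h x)
    (fun k hk hkN τ => sum_norm_sq_mul_cos_eq_zero h (hx k hk hkN) τ) hA
  convert this using 3
  refine sum_congr rfl fun j _ => ?_
  simp [Set.indicator_apply]

theorem exists_walk_of_pow_apply_ne_zero {n : ℕ} {U : Matrix (Fin n) (Fin n) ℂ} {k : ℕ}
    {x y : Fin n} (h : (U ^ k) x y ≠ 0) :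
    ∃ w : ℕ → Fin n, w 0 = x ∧ w k = y ∧ ∀ i < k, U (w i) (w (i + 1)) ≠ 0 := by
  induction k generalizing x with
  | zero =>
    have : x = y := by
      by_contra hne
      exact h (by rw [pow_zero, Matrix.one_apply_ne hne])
    exact ⟨fun _ => x, rfl, this, by simp⟩
  | succ k ih =>
    rw [pow_succ', Matrix.mul_apply] at h
    obtain ⟨z, _, hz⟩ := exists_ne_zero_of_sum_ne_zero h
    obtain ⟨w, hw0, hwk, hw⟩ := ih (right_ne_zero_of_mul hz)
    refine ⟨fun i => Nat.casesOn i x w, rfl, hwk, fun i hi => ?_⟩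
    cases i with
    | zero => simpa [hw0] using left_ne_zero_of_mul hz
    | succ i => exact hw i (by omega)

/-! ### Counting closed walks -/

theorem card_le_of_forall_le_add {n : ℕ} {s : Finset (Fin n)} {m : ℕ}
    (h : ∀ x ∈ s, ∀ y ∈ s, (x : ℕ) ≤ y + m) : s.card ≤ m + 1 := by
  rcases s.eq_empty_or_nonempty with rfl | hs
  · simp
  have hmin := s.min'_mem hs
  have hsub : s.map Fin.valEmbedding ⊆ Finset.Icc (s.min' hs : ℕ) (s.min' hs + m) := by
    intro x hx
    obtain ⟨y, hy, rfl⟩ := mem_map.1 hx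
    exact mem_Icc.2 ⟨Fin.le_def.1 (s.min'_le y hy), h y hy _ hmin⟩
  have := card_le_card hsub
  rw [card_map, Nat.card_Icc] at this
  omega

/-- A relation with at most `D` successors of each of `M` points has at most `M D ^ k` chains of
length `k`. -/
theorem card_chains_le {M D : ℕ} (R : Fin M → Fin M → Prop) [DecidableRel R]
    (hR : ∀ j, (univ.filter (R j)).card ≤ D) (k : ℕ) :
    (univ.filter fun v : Fin (k + 1) → Fin M =>
      ∀ i : Fin k, R (v i.castSucc) (v i.succ)).card ≤ M * D ^ k := by
  induction k with
  | zero => exact (card_filter_le _ _).trans (by simp)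
  | succ k ih =>
    have hfib : ∀ v ∈ (univ.filter fun v : Fin (k + 2) → Fin M =>
        ∀ i : Fin (k + 1), R (v i.castSucc) (v i.succ)).image Fin.init,
        ((univ.filter fun v : Fin (k + 2) → Fin M =>
          ∀ i : Fin (k + 1), R (v i.castSucc) (v i.succ)).filter
            fun u => Fin.init u = v).card ≤ D := by
      intro v _
      refine le_trans ?_ (hR (v (Fin.last k)))
      refine card_le_card_of_injOn (fun u => u (Fin.last (k + 1))) ?_ ?_
      · intro u hu
        simp only [coe_filter, mem_filter, mem_univ, true_and, Set.mem_ofPred_eq] at hu ⊢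
        have := hu.1 (Fin.last k)
        rw [← hu.2]
        exact this
      · intro u hu u' hu' he
        simp only [coe_filter, mem_filter, mem_univ, true_and, Set.mem_ofPred_eq] at hu hu' he
        rw [← Fin.snoc_init_self u, ← Fin.snoc_init_self u', hu.2, hu'.2, he]
    refine (card_le_mul_card_image _ D hfib).trans ?_
    have hsub : (univ.filter fun v : Fin (k + 2) → Fin M =>
        ∀ i : Fin (k + 1), R (v i.castSucc) (v i.succ)).image Fin.init ⊆
        univ.filter fun v : Fin (k + 1) → Fin M => ∀ i : Fin k, R (v i.castSucc) (v i.succ) := by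
      intro v hv
      obtain ⟨u, hu, rfl⟩ := mem_image.1 hv
      simp only [mem_filter, mem_univ, true_and] at hu ⊢
      intro i
      exact hu i.castSucc
    calc D * _ ≤ D * (M * D ^ k) := Nat.mul_le_mul_left _ ((card_le_card hsub).trans ih)
      _ = M * D ^ (k + 1) := by ring

/-- A distance that is at least doubled in each step, up to an error `3`, and that returns to its initial
value is at most `3`. -/
theorem le_three_of_expanding {d : ℕ → ℝ} {k : ℕ} (hk : 0 < k)
    (hd : ∀ i < k, 1 ≤ d i → 2 * d i - 3 ≤ d (i + 1)) (hper : d k = d 0) : d 0 ≤ 3 := by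
  by_contra! h
  have hgrow : ∀ i, i + 1 ≤ k → d 0 < d (i + 1) := by
    intro i
    induction i with
    | zero => intro hi; linarith [hd 0 hi (by linarith)]
    | succ i ih =>
      intro hi
      have := ih (by omega)
      linarith [hd (i + 1) hi (by linarith)]
  obtain ⟨p, rfl⟩ := Nat.exists_eq_add_of_lt hk
  have := hgrow p (by omega)
  rw [zero_add] at hper
  linarith

/-! ### Expansion along walks of cells -/

/-- The affine form of `S` on an atom, with its slope related to the entries of `slopeLcm`. -/
theorem IsAllowable.exists_affine {S : unitInterval → unitInterval} {M₀ : ℕ}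
    (h : IsAllowable S M₀) (j : Fin M₀) :
    ∃ a b : ℝ, 2 ≤ |a| ∧ (∃ m : ℕ, |a| = m ∧ ⌊|cellSlope S M₀ j|⌋₊ = m) ∧
      ∀ t ∈ cell M₀ j, realExt S t = a * t + b := by
  have hM : (0 : ℝ) < M₀ := by exact_mod_cast h.pos
  have hj : (((j : ℕ) : ℝ) + 1) ≤ M₀ := by exact_mod_cast j.2
  obtain ⟨a, b, hab⟩ := h.affine j
  have hext : ∀ t ∈ cell M₀ j, realExt S t = a * t + b := by
    intro t ht
    have h01 : t ∈ Set.Icc (0 : ℝ) 1 :=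
      ⟨le_trans (by positivity) ht.1.le, ht.2.le.trans (by rw [div_le_one hM]; exact hj)⟩
    rw [realExt, Set.projIcc_of_mem zero_le_one h01]
    exact hab ⟨t, h01⟩ ht
  have hmid : (((j : ℕ) : ℝ) + 1 / 2) / M₀ ∈ cell M₀ j := by
    constructor <;> gcongr <;> linarith
  have hslope : cellSlope S M₀ j = a := by
    have : realExt S =ᶠ[𝓝 ((((j : ℕ) : ℝ) + 1 / 2) / M₀)] fun t => a * t + b := by
      filter_upwards [isOpen_Ioo.mem_nhds hmid] with t ht using hext t ht
    rw [cellSlope, this.deriv_eq]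
    simp
  obtain ⟨m, hm⟩ := h.exists_int_slope j
  have hma : a = m := by rw [← hslope]; exact hm _ hmid
  have habs : |a| = (m.natAbs : ℝ) := by rw [hma, ← Int.cast_abs, Nat.cast_natAbs]
  refine ⟨a, b, hslope ▸ h.two_le_slope j, ⟨m.natAbs, habs, ?_⟩, hext⟩
  rw [hslope, habs, Nat.floor_natCast]

theorem IsAllowable.two_le_floor {S : unitInterval → unitInterval} {M₀ : ℕ}
    (h : IsAllowable S M₀) (j : Fin M₀) : 2 ≤ ⌊|cellSlope S M₀ j|⌋₊ :=
  Nat.le_floor (by exact_mod_cast h.two_le_slope j)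

theorem IsAllowable.floor_le_slopeLcm {S : unitInterval → unitInterval} {M₀ : ℕ}
    (h : IsAllowable S M₀) (j : Fin M₀) : ⌊|cellSlope S M₀ j|⌋₊ ≤ slopeLcm S M₀ := by
  refine Nat.le_of_dvd (Nat.pos_of_ne_zero ?_) (dvd_lcm (mem_univ j))
  rw [slopeLcm, Ne, Finset.lcm_eq_zero_iff]
  rintro ⟨i, _, hi⟩
  have := h.two_le_floor i
  omega

theorem IsAllowable.two_le_slopeLcm {S : unitInterval → unitInterval} {M₀ : ℕ}
    (h : IsAllowable S M₀) : 2 ≤ slopeLcm S M₀ :=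
  (h.two_le_floor ⟨0, h.pos⟩).trans (h.floor_le_slopeLcm _)

/-- The transition from `x` to `y` is possible: the image of the cell `x` meets the cell `y`. -/
def Meets (S : unitInterval → unitInterval) (n : ℕ) (x y : Fin n) : Prop :=
  (realExt S '' cell n x ∩ cell n y).Nonempty

theorem IsQuantization.meets {S : unitInterval → unitInterval} {n : ℕ}
    {U : Matrix (Fin n) (Fin n) ℂ} (hU : IsQuantization S n U) {x y : Fin n} (h : U x y ≠ 0) :
    Meets S n x y := by
  by_contra hne
  have h2 := hU.norm_sq x y
  rw [markovMatrix, if_neg (show ¬(realExt S '' cell n x ∩ cell n y).Nonempty from hne)] at h2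
  simp at h2
  exact h h2

theorem mem_cell_iff {n : ℕ} (x : Fin n) (t : ℝ) :
    t ∈ cell n x ↔ ((x : ℕ) : ℝ) < n * t ∧ n * t < ((x : ℕ) : ℝ) + 1 := by
  have hn : (0 : ℝ) < n := by exact_mod_cast x.pos
  rw [cell, Set.mem_Ioo, div_lt_iff₀ hn, lt_div_iff₀ hn, mul_comm t]

open Classical in
theorem IsAllowable.card_meets_le {S : unitInterval → unitInterval} {M₀ : ℕ}
    (h : IsAllowable S M₀) (j : Fin M₀) :
    (univ.filter (Meets S M₀ j)).card ≤ slopeLcm S M₀ + 1 := by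
  obtain ⟨a, b, -, ⟨m, ham, hm⟩, hS⟩ := h.exists_affine j
  have hmL : m ≤ slopeLcm S M₀ := hm ▸ h.floor_le_slopeLcm j
  refine (card_le_of_forall_le_add (m := m) fun i hi i' hi' => ?_).trans (by omega)
  simp only [mem_filter, mem_univ, true_and] at hi hi'
  obtain ⟨_, ⟨t, ht, rfl⟩, hti⟩ := hi
  obtain ⟨_, ⟨t', ht', rfl⟩, hti'⟩ := hi'
  rw [hS t ht] at hti
  rw [hS t' ht'] at hti'
  rw [mem_cell_iff] at ht ht' hti hti'
  have hlt : |M₀ * t - M₀ * t'| < 1 := by rw [abs_lt]; constructor <;> linarith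
  have h1 : a * (M₀ * t - M₀ * t') ≤ m := by
    calc a * (M₀ * t - M₀ * t') ≤ |a| * |M₀ * t - M₀ * t'| := by
          rw [← abs_mul]; exact le_abs_self _
      _ ≤ |a| * 1 := by gcongr
      _ = m := by rw [mul_one, ham]
  have h2 : ((i : ℕ) : ℝ) < ((i' : ℕ) : ℝ) + m + 1 := by nlinarith
  have h3 : (i : ℕ) < (i' : ℕ) + m + 1 := by exact_mod_cast h2
  omega

/-- The atom, among `M₀` equal intervals, that contains the cell `x` of the refinement into
`n = M₀ * q` equal intervals. -/
def atom {M₀ q n : ℕ} (hn : n = M₀ * q) (x : Fin n) : Fin M₀ :=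
  ⟨x / q, Nat.div_lt_of_lt_mul (by have := x.2; rw [mul_comm]; omega)⟩

theorem cell_subset_cell_atom {M₀ q n : ℕ} (hn : n = M₀ * q) (x : Fin n) :
    cell n x ⊆ cell M₀ (atom hn x) := by
  intro t ht
  rw [mem_cell_iff] at ht ⊢
  have hx := x.2
  have hq : 0 < q := by
    rcases Nat.eq_zero_or_pos q with rfl | hq
    · simp at hn; omega
    · exact hq
  have hq' : (0 : ℝ) < q := by exact_mod_cast hq
  have h1 : ((x / q : ℕ) : ℝ) * q ≤ (x : ℕ) := by exact_mod_cast Nat.div_mul_le_self _ _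
  have h2 : ((x : ℕ) : ℝ) + 1 ≤ (((x / q : ℕ) : ℝ) + 1) * q := by
    have : (x : ℕ) < (x / q + 1) * q := by
      rw [add_mul, one_mul]; exact Nat.lt_div_mul_add hq
    exact_mod_cast this
  have h3 : (n : ℝ) * t = (M₀ * t) * q := by rw [hn]; push_cast; ring
  rw [h3] at ht
  exact ⟨lt_of_mul_lt_mul_right (h1.trans_lt ht.1) hq'.le,
    lt_of_mul_lt_mul_right (ht.2.trans_le h2) hq'.le⟩

theorem Meets.atom {S : unitInterval → unitInterval} {M₀ q n : ℕ} (hn : n = M₀ * q) {x y : Fin n}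
    (h : Meets S n x y) : Meets S M₀ (atom hn x) (atom hn y) :=
  h.mono (Set.inter_subset_inter (Set.image_mono (cell_subset_cell_atom hn x))
    (cell_subset_cell_atom hn y))

/-- Two transitions that leave from the same atom expand the distance between cells: it is multiplied
by the slope `|a| ≥ 2`, up to half a cell for each of the four points that replace the cells, where
the errors at the two initial cells are multiplied by `|a|` as well. -/
theorem IsAllowable.expanding {S : unitInterval → unitInterval} {M₀ q n : ℕ}
    (h : IsAllowable S M₀) (hn : n = M₀ * q) {x y x' y' : Fin n} (hxy : Meets S n x y)
    (hxy' : Meets S n x' y') (hat : atom hn x = atom hn x')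
    (hd : 1 ≤ |((x : ℕ) : ℝ) - (x' : ℕ)|) :
    2 * |((x : ℕ) : ℝ) - (x' : ℕ)| - 3 ≤ |((y : ℕ) : ℝ) - (y' : ℕ)| := by
  obtain ⟨a, b, ha, -, hS⟩ := h.exists_affine (QuantumIntervalMap.atom hn x)
  obtain ⟨_, ⟨t, ht, rfl⟩, hty⟩ := hxy
  obtain ⟨_, ⟨t', ht', rfl⟩, hty'⟩ := hxy'
  rw [hS t (cell_subset_cell_atom hn x ht)] at hty
  rw [hS t' (hat ▸ cell_subset_cell_atom hn x' ht')] at hty'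
  rw [mem_cell_iff] at ht ht' hty hty'
  set d := ((x : ℕ) : ℝ) - (x' : ℕ)
  set e := ((y : ℕ) : ℝ) - (y' : ℕ)
  have h1 : |d - (n * t - n * t')| ≤ 1 := by rw [abs_le]; constructor <;> linarith
  have h2 : |a * (n * t - n * t') - e| ≤ 1 := by
    rw [abs_le]; constructor <;> linarith
  have h3 : |a| * |d| ≤ |a| + 1 + |e| := by
    calc |a| * |d| = |a * (d - (n * t - n * t')) + (a * (n * t - n * t') - e) + e| := by
          rw [← abs_mul]; congr 1; ring
      _ ≤ |a * (d - (n * t - n * t'))| + |a * (n * t - n * t') - e| + |e| := abs_add_three _ _ _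
      _ ≤ |a| * 1 + 1 + |e| := by rw [abs_mul]; gcongr
      _ = |a| + 1 + |e| := by ring
  nlinarith

open Classical in
/-- Closed walks of length `k` that visit the same atoms start at most three cells apart, by expansion,
so at most four starting cells belong to each itinerary of atoms. -/
theorem IsAllowable.card_closed_walk_le {S : unitInterval → unitInterval} {M₀ q n : ℕ}
    (h : IsAllowable S M₀) (hn : n = M₀ * q) {k : ℕ} (hk : 0 < k) :
    (univ.filter fun x : Fin n => ∃ w : ℕ → Fin n, w 0 = x ∧ w k = x ∧
      ∀ i < k, Meets S n (w i) (w (i + 1))).card ≤ 4 * (M₀ * (slopeLcm S M₀ + 1) ^ k) := by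
  set B := univ.filter fun x : Fin n => ∃ w : ℕ → Fin n, w 0 = x ∧ w k = x ∧
      ∀ i < k, Meets S n (w i) (w (i + 1)) with hB
  have hw : ∀ x : Fin n, ∃ w : ℕ → Fin n, x ∈ B → w 0 = x ∧ w k = x ∧
      ∀ i < k, Meets S n (w i) (w (i + 1)) := by
    intro x
    by_cases hx : x ∈ B
    · obtain ⟨w, hw⟩ := (mem_filter.1 hx).2
      exact ⟨w, fun _ => hw⟩
    · exact ⟨fun _ => x, fun hx' => absurd hx' hx⟩
  choose w hw using hw
  set f : Fin n → (Fin (k + 1) → Fin M₀) := fun x i => atom hn (w x i) with hf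
  have hfib : ∀ v ∈ B.image f, (B.filter fun x => f x = v).card ≤ 4 := by
    intro v _
    refine card_le_of_forall_le_add (m := 3) fun x hx y hy => ?_
    obtain ⟨hxB, hxv⟩ := mem_filter.1 hx
    obtain ⟨hyB, hyv⟩ := mem_filter.1 hy
    obtain ⟨hx0, hxk, hxw⟩ := hw x hxB
    obtain ⟨hy0, hyk, hyw⟩ := hw y hyB
    have := le_three_of_expanding (d := fun i => |((w x i : ℕ) : ℝ) - (w y i : ℕ)|) hk
      (fun i hi => h.expanding hn (hxw i hi) (hyw i hi)
        (congrFun (hxv.trans hyv.symm) ⟨i, by omega⟩)) (by simp only [hx0, hxk, hy0, hyk])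
    simp only [hx0, hy0] at this
    have h2 : ((x : ℕ) : ℝ) ≤ (y : ℕ) + 3 := by linarith [(abs_le.1 this).2]
    exact_mod_cast h2
  refine (card_le_mul_card_image B 4 hfib).trans (Nat.mul_le_mul_left _ ?_)
  refine le_trans (card_le_card ?_) (card_chains_le (Meets S M₀) h.card_meets_le k)
  intro v hv
  obtain ⟨x, hx, rfl⟩ := mem_image.1 hv
  simp only [mem_filter, mem_univ, true_and]
  intro i
  exact ((hw x hx).2.2 i i.2).atom hn

/-! ### The exceptional coordinates -/

open Classical in
/-- The coordinates `x` at which the diagonal entry of some power `U ^ k`, `1 ≤ k ≤ N`, is nonzero. -/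
noncomputable def badSet {n : ℕ} (U : Matrix (Fin n) (Fin n) ℂ) (N : ℕ) : Finset (Fin n) :=
  univ.filter fun x => ∃ k, 0 < k ∧ k ≤ N ∧ (U ^ k) x x ≠ 0

theorem mem_badSet {n : ℕ} {U : Matrix (Fin n) (Fin n) ℂ} {N : ℕ} {x : Fin n} :
    x ∈ badSet U N ↔ ∃ k, 0 < k ∧ k ≤ N ∧ (U ^ k) x x ≠ 0 := by
  simp [badSet]

theorem IsAllowable.card_badSet_le {S : unitInterval → unitInterval} {M₀ n : ℕ}
    (h : IsAllowable S M₀) (hn : M₀ ∣ n) {U : Matrix (Fin n) (Fin n) ℂ}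
    (hU : IsQuantization S n U) (N : ℕ) :
    (badSet U N).card ≤ 4 * N * M₀ * slopeLcm S M₀ ^ (2 * N) := by
  classical
  obtain ⟨q, hq⟩ := hn
  have hL := h.two_le_slopeLcm
  set L := slopeLcm S M₀
  have hsub : badSet U N ⊆ (Finset.Icc 1 N).biUnion fun k =>
      univ.filter fun x : Fin n => ∃ w : ℕ → Fin n, w 0 = x ∧ w k = x ∧
        ∀ i < k, Meets S n (w i) (w (i + 1)) := by
    intro x hx
    obtain ⟨k, hk0, hkN, hne⟩ := mem_badSet.1 hx
    obtain ⟨w, h0, hwk, hw⟩ := exists_walk_of_pow_apply_ne_zero hne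
    exact mem_biUnion.2 ⟨k, mem_Icc.2 ⟨hk0, hkN⟩, mem_filter.2 ⟨mem_univ _, w, h0, hwk, fun i hi =>
      hU.meets (hw i hi)⟩⟩
  refine (card_le_card hsub).trans (card_biUnion_le.trans ?_)
  have hterm : ∀ k ∈ Finset.Icc 1 N, (univ.filter fun x : Fin n => ∃ w : ℕ → Fin n,
      w 0 = x ∧ w k = x ∧ ∀ i < k, Meets S n (w i) (w (i + 1))).card ≤ 4 * M₀ * L ^ (2 * N) := by
    intro k hk
    have hk := mem_Icc.1 hk
    refine (h.card_closed_walk_le hq hk.1).trans ?_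
    rw [← mul_assoc]
    refine Nat.mul_le_mul_left _ ?_
    -- Only `L ≥ 2` is used here: the crude count `L + 1` of successors costs at most a square.
    calc (L + 1) ^ k ≤ (L ^ 2) ^ k := Nat.pow_le_pow_left (by nlinarith) _
      _ = L ^ (2 * k) := by rw [pow_mul]
      _ ≤ L ^ (2 * N) := Nat.pow_le_pow_right (by omega) (by omega)
  refine (sum_le_card_nsmul _ _ _ hterm).trans (le_of_eq ?_)
  simp
  ring

/-- With the powers restricted to `k ≤ K / 4`, the number of itineraries is at most about `L₀ ^ (K / 2)`
per atom, while there are at least `L₀ ^ K` cells per atom. -/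
theorem IsAllowable.card_badSet_div_le {S : unitInterval → unitInterval} {M₀ n : ℕ}
    (h : IsAllowable S M₀) (hn0 : 0 < n) (hn : M₀ ∣ n) {U : Matrix (Fin n) (Fin n) ℂ}
    (hU : IsQuantization S n U) :
    ((badSet U (Ktilde S M₀ n / 4)).card : ℝ) / n ≤
      Ktilde S M₀ n * (√2)⁻¹ ^ Ktilde S M₀ n := by
  have hL := h.two_le_slopeLcm
  set K := Ktilde S M₀ n with hK
  set N := K / 4
  have hcard := h.card_badSet_le hn hU N
  set L := slopeLcm S M₀ with hLdef
  have hdvd : L ^ K ∣ n / M₀ := pow_multiplicity_dvd _ _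
  have hnM : 0 < n / M₀ := Nat.div_pos (Nat.le_of_dvd hn0 hn) h.pos
  have hle : M₀ * L ^ K ≤ n := by
    calc M₀ * L ^ K ≤ M₀ * (n / M₀) := Nat.mul_le_mul_left _ (Nat.le_of_dvd hnM hdvd)
      _ = n := Nat.mul_div_cancel' hn
  have hN : 4 * N ≤ K := Nat.mul_div_le K 4
  have hmain : (badSet U N).card * 2 ^ (K - 2 * N) ≤ K * n := by
    calc (badSet U N).card * 2 ^ (K - 2 * N)
        ≤ (4 * N * M₀ * L ^ (2 * N)) * L ^ (K - 2 * N) :=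
          Nat.mul_le_mul hcard (Nat.pow_le_pow_left hL _)
      _ = 4 * N * (M₀ * (L ^ (2 * N) * L ^ (K - 2 * N))) := by ring
      _ = 4 * N * (M₀ * L ^ K) := by rw [← pow_add]; congr 4; omega
      _ ≤ K * n := Nat.mul_le_mul hN hle
  have hmain' : ((badSet U N).card : ℝ) * 2 ^ (K - 2 * N) ≤ K * n := by exact_mod_cast hmain
  have hsqrt : √2 ^ K ≤ (2 : ℝ) ^ (K - 2 * N) := by
    calc √2 ^ K ≤ √2 ^ (2 * (K - 2 * N)) :=
          pow_le_pow_right₀ (Real.one_le_sqrt.2 (by norm_num)) (by omega)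
      _ = 2 ^ (K - 2 * N) := by rw [pow_mul, Real.sq_sqrt (by norm_num)]
  have hn' : (0 : ℝ) < n := by exact_mod_cast hn0
  rw [inv_pow, ← div_eq_mul_inv, div_le_div_iff₀ hn' (by positivity)]
  exact (mul_le_mul_of_nonneg_left hsqrt (by positivity)).trans hmain'

end QuantumIntervalMap

theorem theorem2p1 :
    -- the error term: a function of the dimension `n`, the length `|I(n)|` and `K̃(n)` only
    ∃ ε : ℕ → ℝ → ℕ → ℝ,
      ∀ (S : unitInterval → unitInterval) (M₀ : ℕ), QuantumIntervalMap.IsAllowable S M₀ →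
      ∀ n : ℕ → ℕ, (∀ k, 0 < n k ∧ M₀ ∣ n k) →
      Tendsto (fun k => QuantumIntervalMap.Ktilde S M₀ (n k)) atTop atTop →
      ∀ U : ∀ k, Matrix (Fin (n k)) (Fin (n k)) ℂ,
      (∀ k, QuantumIntervalMap.IsQuantization S (n k) (U k)) →
      -- the sets of good coordinates, chosen before the intervals
      ∃ G : ∀ k, Finset (Fin (n k)),
        ∀ (θ : ∀ k, Fin (n k) → ℝ)
          (ψ : ∀ k, OrthonormalBasis (Fin (n k)) ℂ (EuclideanSpace ℂ (Fin (n k)))),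
        (∀ k, QuantumIntervalMap.IsEigenbasis (U k) (θ k) (ψ k)) →
        ∀ (I : ℕ → Set Real.Angle) (ℓ : ℕ → ℝ), (∀ k, QuantumIntervalMap.IsArc (I k) (ℓ k)) →
        Tendsto (fun k => ℓ k * (QuantumIntervalMap.Ktilde S M₀ (n k) : ℝ)) atTop atTop →
          -- `#G_{n_k} = n_k (1 - o(|I(n_k)|))`
          ((fun k => 1 - ((G k).card : ℝ) / (n k : ℝ)) =o[atTop] ℓ) ∧
          Tendsto (fun k => ε (n k) (ℓ k) (QuantumIntervalMap.Ktilde S M₀ (n k))) atTop (𝓝 0) ∧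
          ∀ k, 0 < ℓ k → ∀ x ∈ G k,
            |QuantumIntervalMap.spectralDiag (θ k) (ψ k) (I k) x - ℓ k / (2 * Real.pi)| ≤
              ℓ k / (2 * Real.pi) * ε (n k) (ℓ k) (QuantumIntervalMap.Ktilde S M₀ (n k)) := by

  classical
  -- The bound `16 / (K / 4 + 1) ≤ 64 / (K + 1)` divided by `ℓ / (2π)`; the denominator `K + 1` in place
  -- of `K` keeps it a genuine bound for `K = 0`.
  refine ⟨fun _ ℓ K => 128 * Real.pi / (ℓ * (K + 1)), ?_⟩
  intro S M₀ hS n hn hK U hU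
  set K := fun k => QuantumIntervalMap.Ktilde S M₀ (n k) with hKdef
  refine ⟨fun k => (QuantumIntervalMap.badSet (U k) (K k / 4))ᶜ, ?_⟩
  intro θ ψ hψ I ℓ hI hℓ
  refine ⟨?_, ?_, ?_⟩
  · rw [isLittleO_iff]
    intro c hc
    have hr : |(√2)⁻¹| < 1 := by
      rw [abs_of_pos (by positivity)]
      exact inv_lt_one_of_one_lt₀ (Real.one_lt_sqrt_two)
    have hlim := (tendsto_pow_const_mul_const_pow_of_abs_lt_one 2 hr).comp hK
    -- Eventually `K ^ 2 * (√2)⁻¹ ^ K ≤ c` and `1 ≤ ℓ * K`, so that `K * (√2)⁻¹ ^ K ≤ c * ℓ`.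
    filter_upwards [hlim.eventually_le_const hc, hℓ.eventually_ge_atTop 1,
      hK.eventually_ge_atTop 1] with k hk1 hk2 hk3
    have hn' : (0 : ℝ) < n k := by exact_mod_cast (hn k).1
    have hcard : 1 - (((QuantumIntervalMap.badSet (U k) (K k / 4))ᶜ.card : ℝ)) / n k =
        ((QuantumIntervalMap.badSet (U k) (K k / 4)).card : ℝ) / n k := by
      rw [Finset.card_compl, Fintype.card_fin, Nat.cast_sub
        ((Finset.card_le_univ _).trans_eq (Fintype.card_fin _))]
      field_simp
      ring
    rw [hcard, Real.norm_of_nonneg (by positivity), Real.norm_of_nonneg (hI k).1]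
    refine (hS.card_badSet_div_le (hn k).1 (hn k).2 (hU k)).trans ?_
    have hKpos : (0 : ℝ) < K k := by exact_mod_cast hk3
    simp only [Function.comp_apply] at hk1
    refine le_of_mul_le_mul_right ?_ hKpos
    calc (K k : ℝ) * (√2)⁻¹ ^ K k * K k = (K k : ℝ) ^ 2 * (√2)⁻¹ ^ K k := by ring
      _ ≤ c * 1 := by rw [mul_one]; exact hk1
      _ ≤ c * (ℓ k * K k) := by gcongr
      _ = c * ℓ k * K k := by ring
  · refine Tendsto.const_div_atTop (tendsto_atTop_mono (fun k => ?_) hℓ) _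
    have := (hI k).1
    gcongr
    linarith
  · intro k hk x hx
    have hx' : ∀ m, 0 < m → m ≤ K k / 4 → (U k ^ m) x x = 0 := by
      intro m h0 hm
      by_contra hne
      exact Finset.mem_compl.1 hx (QuantumIntervalMap.mem_badSet.2 ⟨m, h0, hm, hne⟩)
    refine (QuantumIntervalMap.abs_spectralDiag_sub_le (hψ k) hx' (hI k)).trans ?_
    have h4 : (K k : ℝ) + 1 ≤ 4 * ((K k / 4 : ℕ) + 1) := by
      have : K k + 1 ≤ 4 * (K k / 4 + 1) := by omega
      exact_mod_cast this
    have e : ℓ k / (2 * Real.pi) * (128 * Real.pi / (ℓ k * (K k + 1))) = 64 / (K k + 1) := by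
      field_simp
      ring
    rw [e, div_le_div_iff₀ (by positivity) (by positivity)]
    linarith
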